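/- Let $d\ge 1$, $\alpha>0$, $\lambda>0$, let $W$ be a distribution with $\mathbb P(W\ge 1)=1$ and $L$ a distribution on $[0,\infty)$. Let $(W_x)_{x\in\mathbb Z^d}$ be i.i.d. copies of $W$ (the environment), and for $x\ne y$ put $r_{xy}=\lambda W_xW_y/\|x-y\|^{\alpha}$ (Euclidean norm), $r_{xx}=0$. Consider the following three processes. * $\mathrm{SFP}_{W,L}$: the random graph on $\mathbb Z^d$ in which, given the environment, the edges are independently present, $\{x,y\}$ with probability $1$ if $\|x-y\|=1$ and $1-e^{-r_{xy}}$ if $\|x-y\|>1$; all edges carry i.i.d. edge-weights with distribution $L$. The $L$-length of a path is the sum of its edge-weights. $\mathcal B^{L,S}_t(0)$ is the tree formed by the vertices and edges on shortest paths (paths of minimal $L$-length between their endpoints) of $L$-length at most $t$ from $0$, including vertex-weights and edge-weights. If a vertex has several shortest paths from $0$, the tree uses the one with the fewest edges, remaining ties being broken lexicographically according to a fixed enumeration of $\mathbb Z^d$. * $\mathrm{PoiBRW}$: a branching random walk in the environment. The root is located at $0$. Given the environment, an individual located at $x$ has, independently for all individuals and all $y\in\mathbb Z^d$, $\mathrm{Poi}(r_{xy})$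 children located at $y$, and in addition one child at each $y$ with $\|x-y\|=1$. All parent–child edges carry i.i.d. edge-weights with distribution $L$; an individual at $y$ has vertex-weight $W_y$. * $\mathrm{BerBRW}$: the same, except that an individual at $x$ has one child at $y$ with probability $1$ if $\|x-y\|=1$ and with probability $1-e^{-r_{xy}}$ otherwise, and no child at $y$ else. $\mathcal B^{L,P}_t(0)$ and $\mathcal B^{L,B}_t(0)$ denote the trees spanned by the individuals of $\mathrm{PoiBRW}$ and $\mathrm{BerBRW}$ within $L$-distance $t$ of the root, including locations, vertex-weights and edge-weights. Theorem. There is a coupling of $\mathrm{PoiBRW}$, $\mathrm{BerBRW}$ and $\mathrm{SFP}_{W,L}$ on one probability space, with the same environment, in which $\mathrm{BerBRW}$ is a thinning of $\mathrm{PoiBRW}$ (each of its individuals keeps exactly one child, with its edge-weight, at every site at which she has at least one child in $\mathrm{PoiBRW}$; at a nearest-neighbor site the kept child is the additional one), such that almost surely, for all $t\ge 0$, $$\mathcal B^{L,S}_t(0)\subseteq \mathcal B^{L,B}_t(0)\subseteq \mathcal B^{L,P}_t(0).$$ The second inclusion is one of sets of individuals with their edges, locations and weights. The first means that $\mathcal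 B^{L,S}_t(0)$ is embedded in $\mathcal B^{L,B}_t(0)$ as a subtree by an injective map (the same for all $t$) that sends $0$ to the root, sends edges (directed away from $0$) to parent–child edges, and preserves locations, vertex-weights and edge-weights. -/

import Mathlib

open MeasureTheory ProbabilityTheory
open scoped ENNReal NNReal

noncomputable section

namespace SFPCoupling

/-! ### The lattice, the environment and the connection rates -/

/-- The lattice `ℤ ^ d`. -/
abbrev Site (d : ℕ) := Fin d → ℤ

/-- An environment: one vertex-weight for every site. -/
abbrev Env (d : ℕ) := Site d → ℝ

variable {d : ℕ}

/-- Euclidean distance of two sites. -/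
def eucl (x y : Site d) : ℝ := Real.sqrt (∑ i, ((x i : ℝ) - (y i : ℝ)) ^ 2)

theorem eucl_comm (x y : Site d) : eucl x y = eucl y x := by
  unfold eucl
  congr 1
  exact Finset.sum_congr rfl fun i _ => by ring

/-- The rate `lam * W_x * W_y / ‖x - y‖ ^ α` for `x ≠ y`, and `0` for `x = y`. -/
def rate (α lam : ℝ) (w : Env d) (x y : Site d) : ℝ≥0 :=
  if x = y then 0 else (lam * (w x * w y) / eucl x y ^ α).toNNReal

theorem rate_comm (α lam : ℝ) (w : Env d) (x y : Site d) :
    rate α lam w x y = rate α lam w y x := by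
  unfold rate
  rw [eucl_comm, mul_comm (w x)]
  simp only [eq_comm]

open Classical in
/-- The connection probability of `x` and `y` given the environment: `1` for nearest neighbours,
`1 - exp (- lam * W_x * W_y / ‖x - y‖ ^ α)` for other pairs of distinct sites, `0` for `x = y`. -/
def connProb (α lam : ℝ) (w : Env d) (x y : Site d) : unitInterval :=
  if eucl x y = 1 then 1
  else ⟨1 - Real.exp (-(rate α lam w x y : ℝ)), by
    constructor
    · have : Real.exp (-(rate α lam w x y : ℝ)) ≤ 1 :=
        Real.exp_le_one_iff.2 (neg_nonpos.2 (NNReal.coe_nonneg _))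
      linarith
    · have := Real.exp_pos (-(rate α lam w x y : ℝ))
      linarith⟩

theorem connProb_comm (α lam : ℝ) (w : Env d) (x y : Site d) :
    connProb α lam w x y = connProb α lam w y x := by
  unfold connProb
  simp only [eucl_comm x y, rate_comm α lam w x y]

/-- The connection probability of an unordered pair of sites. -/
def connProbSym (α lam : ℝ) (w : Env d) : Sym2 (Site d) → unitInterval :=
  Sym2.lift ⟨connProb α lam w, connProb_comm α lam w⟩

/-- `X` is a random element whose law in the i.i.d. environment `W` (with marginal law `ν`) is the
family `Q`: the vertex-weights `W x` are i.i.d. with law `ν`, and conditionally on `W = w` the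
law of `X` is `Q w`. -/
def HasLawInEnv {Ω S : Type} [MeasurableSpace Ω] [MeasurableSpace S] (P : Measure Ω)
    (ν : Measure ℝ) (W : Ω → Env d) (X : Ω → S) (Q : Env d → Measure S) : Prop :=
  Measurable W ∧ Measurable X ∧
    ∀ (A : Set (Env d)) (B : Set S), MeasurableSet A → MeasurableSet B →
      P (W ⁻¹' A ∩ X ⁻¹' B) = ∫⁻ w in A, Q w B ∂(Measure.infinitePi fun _ : Site d => ν)

/-! ### Scale-free percolation with edge-weights -/

/-- A sample of the edges: for each unordered pair of sites, whether the edge is present, and an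
edge-weight (which only matters if the edge is present). -/
abbrev EdgeConf (d : ℕ) := (Sym2 (Site d) → Bool) × (Sym2 (Site d) → ℝ)

/-- The conditional law of scale-free percolation with edge-weights given the environment `w`:
edges are independently present with the connection probabilities, and the edge-weights are
i.i.d. with law `ρ`. -/
def sfpLaw (α lam : ℝ) (ρ : Measure ℝ) (w : Env d) : Measure (EdgeConf d) :=
  (Measure.infinitePi fun e : Sym2 (Site d) =>
      bernoulliMeasure true false (connProbSym α lam w e)).prod
    (Measure.infinitePi fun _ : Sym2 (Site d) => ρ)

/-- The graph formed by the edges that are present. -/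
def sfpGraph (s : EdgeConf d) : SimpleGraph (Site d) :=
  SimpleGraph.fromEdgeSet {e | s.1 e = true}

/-- The `L`-length of a walk: the sum of its edge-weights. -/
def lLength (s : EdgeConf d) {x y : Site d} (p : (sfpGraph s).Walk x y) : ℝ :=
  (p.edges.map s.2).sum

/-- `p` is a path of minimal `L`-length between its endpoints. -/
def IsShortest (s : EdgeConf d) {x y : Site d} (p : (sfpGraph s).Walk x y) : Prop :=
  p.IsPath ∧ ∀ q : (sfpGraph s).Walk x y, q.IsPath → lLength s p ≤ lLength s q

/-- `p` is the shortest path between its endpoints, where ties between several paths of minimal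
`L`-length are broken by the number of edges and then lexicographically, according to the
enumeration `e` of the sites. If there is only one path of minimal `L`-length, this is that path. -/
def IsTreePath (e : Site d ↪ ℕ) (s : EdgeConf d) {x y : Site d}
    (p : (sfpGraph s).Walk x y) : Prop :=
  IsShortest s p ∧ ∀ q : (sfpGraph s).Walk x y, IsShortest s q →
    p.length < q.length ∨ (p.length = q.length ∧ p.support.map e ≤ q.support.map e)

/-! ### Rooted weighted graphs embedded in the lattice -/

/-- A rooted graph with vertices of type `V`, located in `ℤ ^ d`, with vertex-weights and
edge-weights; edges are directed away from the root. -/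
structure SpatialGraph (d : ℕ) (V : Type) where
  root : V
  verts : Set V
  edge : V → V → Prop
  loc : V → Site d
  vertexWeight : V → ℝ
  edgeWeight : V → V → ℝ

/-- `φ` realises `G` as a subgraph of `H`: it maps the vertices of `G` injectively to vertices of
`H` and the edges of `G` to edges of `H`, and it preserves the root, the locations, the
vertex-weights and the edge-weights. -/
structure SpatialGraph.IsSubgraphVia {V V' : Type} (φ : V → V') (G : SpatialGraph d V)
    (H : SpatialGraph d V') : Prop where
  map_root : φ G.root = H.root
  mapsTo : Set.MapsTo φ G.verts H.verts
  injOn : Set.InjOn φ G.verts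
  map_loc : ∀ x ∈ G.verts, H.loc (φ x) = G.loc x
  map_vertexWeight : ∀ x ∈ G.verts, H.vertexWeight (φ x) = G.vertexWeight x
  map_edge : ∀ x y, G.edge x y → H.edge (φ x) (φ y)
  map_edgeWeight : ∀ x y, G.edge x y → H.edgeWeight (φ x) (φ y) = G.edgeWeight x y

/-- The shortest-path tree of the origin up to `L`-distance `t`: all vertices and edges on the
shortest paths (with ties broken as above) of `L`-length at most `t` that start at `0`. -/
def shortestPathTree (e : Site d ↪ ℕ) (w : Env d) (s : EdgeConf d) (t : ℝ) :
    SpatialGraph d (Site d) where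
  root := 0
  verts := {x | ∃ (z : Site d) (p : (sfpGraph s).Walk 0 z),
    IsTreePath e s p ∧ lLength s p ≤ t ∧ x ∈ p.support}
  edge x y := ∃ (z : Site d) (p : (sfpGraph s).Walk 0 z),
    IsTreePath e s p ∧ lLength s p ≤ t ∧ (x, y) ∈ p.darts.map SimpleGraph.Dart.toProd
  loc x := x
  vertexWeight x := w x
  edgeWeight x y := s.2 s(x, y)

/-! ### Branching random walks -/

/-- Names of individuals: `[]` is the root and `(y, k) :: a` is the child of `a` that has number
`k` (counting from `0`) among the children of `a` that are located at `y`. -/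
abbrev Indiv (d : ℕ) := List (Site d × ℕ)

/-- The location of an individual; the root is at the origin. -/
def Indiv.site : Indiv d → Site d
  | [] => 0
  | (y, _) :: _ => y

/-- A sample of a branching random walk: the number of children that an individual has at a site,
and the edge-weight between an individual and her parent. Both are given for all conceivable
names, but they only matter for the individuals that are born. -/
abbrev BRWConf (d : ℕ) := (Indiv d × Site d → ℕ) × (Indiv d → ℝ)

/-- The individual is present in the branching random walk. -/
def Born (c : BRWConf d) : Indiv d → Prop
  | [] => True
  | (y, k) :: a => k < c.1 (a, y) ∧ Born c a

/-- The `L`-distance of an individual from the root. -/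
def rootDist (c : BRWConf d) : Indiv d → ℝ
  | [] => 0
  | b :: a => rootDist c a + c.2 (b :: a)

/-- The graph spanned by the individuals within `L`-distance `t` of the root. -/
def brwBall (w : Env d) (c : BRWConf d) (t : ℝ) : SpatialGraph d (Indiv d) where
  root := []
  verts := {a | Born c a ∧ rootDist c a ≤ t}
  edge a b := (Born c a ∧ rootDist c a ≤ t) ∧ (Born c b ∧ rootDist c b ≤ t) ∧
    ∃ m : Site d × ℕ, b = m :: a
  loc a := Indiv.site a
  vertexWeight a := w (Indiv.site a)
  edgeWeight _ b := c.2 b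

open Classical in
/-- The law of the number of children at `y` of an individual located at `x` in the Poisson
branching random walk: a Poisson variable, plus one additional child if `y` is a nearest neighbour
of `x`. The additional child has number `0`. -/
def poiOffspring (α lam : ℝ) (w : Env d) (x y : Site d) : Measure ℕ :=
  if eucl x y = 1 then (poissonMeasure (rate α lam w x y)).map (fun n => n + 1)
  else poissonMeasure (rate α lam w x y)

/-- The law of the number of children at `y` of an individual located at `x` in the Bernoulli
branching random walk: one child with the connection probability of `x` and `y`, else none. -/
def berOffspring (α lam : ℝ) (w : Env d) (x y : Site d) : Measure ℕ :=
  bernoulliMeasure 1 0 (connProb α lam w x y)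

/-- The conditional law, given the environment, of a branching random walk in which all numbers of
children are independent, with offspring law `μ x y` for the children at `y` of an individual at
`x`, and in which the edge-weights are i.i.d. with law `ρ`. -/
def brwLaw (μ : Site d → Site d → Measure ℕ) (ρ : Measure ℝ) : Measure (BRWConf d) :=
  (Measure.infinitePi fun i : Indiv d × Site d => μ (Indiv.site i.1) i.2).prod
    (Measure.infinitePi fun _ : Indiv d => ρ)

/-- The Bernoulli branching random walk `b` is the thinning of the Poisson branching random walk
`p`: each individual of `b` keeps exactly one child (the one with number `0`) at every site at
which she has at least one child in `p`, with the same edge-weight. -/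
def IsThinning (b p : BRWConf d) : Prop :=
  (∀ a y, Born b a → b.1 (a, y) = min 1 (p.1 (a, y))) ∧ ∀ a, Born b a → b.2 a = p.2 a

end SFPCoupling

end

open SFPCoupling

namespace SFPCoupling

/-! ### Product measures -/

section ProductMeasures

variable {ι κ A B : Type*} [MeasurableSpace A] [MeasurableSpace B]

/-! Given the environment, every pair of sites receives a number of connections with the Poisson
offspring law (additional child included) and an edge-weight; an independent Poisson branching
random walk serves as a reservoir. Pairs with at least one connection form the percolation graph.
Its paths from the origin are ordered by length, number of edges and sites. The first path that
reaches an endpoint of an edge claims that edge: its number of connections becomes an offspring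
number of the individual whose ancestors follow the path and all have number 0, and its weight goes
to her child with number 0. All other coordinates are taken from the reservoir. This is the Poisson
walk; keeping one child per site gives the Bernoulli walk.

The law is correct (`IsExploration.map_explore`) because each mark is used at most once and the
decision to use it does not depend on its value. A stepwise exploration is avoided, since infinitely
many paths may compete and no first one need exist; an edge without a first path is simply not used.
Instead, the conditional probability of a box given the marks is a product of factors `m j + q j`,
where `q j` is centred and lives on the event that `j` is revealed. A product of some `q j` is split
according to the factor revealed last; resampling the mark of that factor changes nothing else, so
the integral vanishes. The required invariance is `Leading.congr`: a path affected by changing an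
edge has an unaffected initial piece that already reaches this edge, so it comes later in the order.

The percolation tree embeds because its paths are minimal (`IsTreePath.isMinimal`), minimality
passes to initial pieces (`IsMinimal.of_cons`), and the last edge of a minimal path is claimed by
the path before it (`IsMinimal.leading`). So the walk reproduces the tree's edges and weights. -/

theorem prod_infinitePi_eq_of_boxes (μ : ι → Measure A) (ρ : κ → Measure B)
    [∀ i, IsProbabilityMeasure (μ i)] [∀ i, IsProbabilityMeasure (ρ i)]
    {m : Measure ((ι → A) × (κ → B))}
    (h : ∀ (s : Finset ι) (t : Finset κ) (a : ι → Set A) (b : κ → Set B),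
      (∀ i, MeasurableSet (a i)) → (∀ i, MeasurableSet (b i)) →
      m ((s : Set ι).pi a ×ˢ (t : Set κ).pi b) =
        (∏ i ∈ s, μ i (a i)) * ∏ i ∈ t, ρ i (b i)) :
    (Measure.infinitePi μ).prod (Measure.infinitePi ρ) = m := by
  refine Measure.prod_eq_generateFrom generateFrom_squareCylinders generateFrom_squareCylinders
    (isPiSystem_squareCylinders (fun _ => MeasurableSpace.isPiSystem_measurableSet) (by simp))
    (isPiSystem_squareCylinders (fun _ => MeasurableSpace.isPiSystem_measurableSet) (by simp))
    ⟨fun _ => Set.univ, fun _ => ⟨∅, fun _ => Set.univ, by simp, by simp⟩,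
      fun _ => measure_lt_top _ _, Set.iUnion_const _⟩
    ⟨fun _ => Set.univ, fun _ => ⟨∅, fun _ => Set.univ, by simp, by simp⟩,
      fun _ => measure_lt_top _ _, Set.iUnion_const _⟩ ?_
  rintro _ ⟨s, a, ha, rfl⟩ _ ⟨t, b, hb, rfl⟩
  have ha' : ∀ i, MeasurableSet (a i) := fun i => ha i (Set.mem_univ i)
  have hb' : ∀ i, MeasurableSet (b i) := fun i => hb i (Set.mem_univ i)
  rw [h s t a b ha' hb', Measure.infinitePi_pi _ fun i _ => ha' i,
    Measure.infinitePi_pi _ fun i _ => hb' i]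

theorem measurable_infinitePi {Θ : Type*} [MeasurableSpace Θ] (μ : Θ → ι → Measure A)
    [∀ w i, IsProbabilityMeasure (μ w i)] (hμ : ∀ i, Measurable fun w => μ w i) :
    Measurable fun w => Measure.infinitePi (μ w) := by
  refine Measurable.measure_of_isPiSystem_of_isProbabilityMeasure
    generateFrom_squareCylinders.symm
    (isPiSystem_squareCylinders (fun _ => MeasurableSpace.isPiSystem_measurableSet) (by simp)) ?_
  rintro _ ⟨s, a, ha, rfl⟩
  have ha' : ∀ i, MeasurableSet (a i) := fun i => ha i (Set.mem_univ i)
  simp_rw [Measure.infinitePi_pi _ fun i _ => ha' i]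
  exact Finset.measurable_fun_prod s fun i _ => (Measure.measurable_coe (ha' i)).comp (hμ i)

-- Resampling one coordinate of a product measure: on a cylinder, the old value at `i` is
-- unconstrained and the fresh one takes over its constraint.
open Classical in
theorem measurePreserving_update (μ : ι → Measure A) [∀ i, IsProbabilityMeasure (μ i)] (i : ι) :
    MeasurePreserving (fun p : (ι → A) × A => Function.update p.1 i p.2)
      ((Measure.infinitePi μ).prod (μ i)) (Measure.infinitePi μ) := by
  have hm : Measurable (fun p : (ι → A) × A => Function.update p.1 i p.2) := by
    refine measurable_pi_lambda _ fun j => ?_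
    by_cases hj : j = i
    · subst hj; simpa using measurable_snd
    · simp only [Function.update_of_ne hj]
      exact (measurable_pi_apply j).comp measurable_fst
  refine ⟨hm, Measure.eq_infinitePi _ fun s t ht => ?_⟩
  rw [Measure.map_apply hm (.pi s.countable_toSet fun j _ => ht j)]
  have : (fun p : (ι → A) × A => Function.update p.1 i p.2) ⁻¹' ((s : Set ι).pi t) =
      ((s.erase i : Finset ι) : Set ι).pi t ×ˢ (if i ∈ s then t i else Set.univ) := by
    ext ⟨x, u⟩
    simp only [Set.mem_preimage, Set.mem_pi, Set.mem_prod, Finset.mem_coe, Finset.mem_erase]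
    constructor
    · intro h
      refine ⟨fun j hj => by simpa [Function.update_of_ne hj.1] using h j hj.2, ?_⟩
      split_ifs with hi
      · simpa using h i hi
      · trivial
    · rintro ⟨h1, h2⟩ j hj
      by_cases hji : j = i
      · subst hji; simpa [hj] using h2
      · simpa [Function.update_of_ne hji] using h1 j ⟨hji, hj⟩
  rw [this, Measure.prod_prod, Measure.infinitePi_pi _ fun j _ => ht j]
  split_ifs with hi
  · exact Finset.prod_erase_mul s (fun j => μ j (t j)) hi
  · simp [Finset.erase_eq_of_notMem hi]

end ProductMeasures

/-! ### Resampling -/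

/-- After resampling, `h` depends only on the old sample and `k` only on the fresh one, so the
integral factorises and the centred factor kills it. -/
theorem integral_mul_eq_zero_of_resample {Ω S : Type*} [MeasurableSpace Ω] [MeasurableSpace S]
    {P : Measure Ω} {μ : Measure S} [SFinite P] [SFinite μ] {r : Ω × S → Ω}
    (hr : MeasurePreserving r (P.prod μ) P) {h k : Ω → ℝ} {g : S → ℝ}
    (hh : Measurable h) (hk : Measurable k) (hhr : ∀ p, h (r p) = h p.1)
    (hkr : ∀ p, k (r p) = g p.2) (hg : ∫ u, g u ∂μ = 0) : ∫ ω, h ω * k ω ∂P = 0 := by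
  have hm : Measurable fun ω => h ω * k ω := hh.mul hk
  rw [← hr.map_eq, integral_map hr.measurable.aemeasurable hm.aestronglyMeasurable]
  simp_rw [hhr, hkr]
  rw [integral_prod_mul, hg, mul_zero]

section Resample

variable {ι κ A B : Type*} [MeasurableSpace A] [MeasurableSpace B]
  (μ : ι → Measure A) (ρ : κ → Measure B)
  [∀ i, IsProbabilityMeasure (μ i)] [∀ i, IsProbabilityMeasure (ρ i)]

open Classical in
theorem measurePreserving_update_fst (i : ι) :
    MeasurePreserving (fun p : ((ι → A) × (κ → B)) × A => (Function.update p.1.1 i p.2, p.1.2))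
      (((Measure.infinitePi μ).prod (Measure.infinitePi ρ)).prod (μ i))
      ((Measure.infinitePi μ).prod (Measure.infinitePi ρ)) :=
  ((measurePreserving_update μ i).prod (MeasurePreserving.id _)).comp
    ((measurePreserving_prodAssoc _ _ _).symm MeasurableEquiv.prodAssoc |>.comp
      (((MeasurePreserving.id _).prod Measure.measurePreserving_swap).comp
        (measurePreserving_prodAssoc _ _ _)))

open Classical in
theorem measurePreserving_update_snd (i : κ) :
    MeasurePreserving (fun p : ((ι → A) × (κ → B)) × B => (p.1.1, Function.update p.1.2 i p.2))
      (((Measure.infinitePi μ).prod (Measure.infinitePi ρ)).prod (ρ i))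
      ((Measure.infinitePi μ).prod (Measure.infinitePi ρ)) :=
  ((MeasurePreserving.id _).prod (measurePreserving_update ρ i)).comp
    (measurePreserving_prodAssoc _ _ _)

end Resample

/-! ### Products of perturbed constants -/

section Expansion

variable {Ω T : Type*}

-- Expanding the product over subsets, every term with at least one perturbation integrates to zero;
-- only the product of the constants survives.
open Classical in
theorem integral_prod_const_add [MeasurableSpace Ω] {P : Measure Ω} [IsProbabilityMeasure P]
    (I : Finset T) (m : T → ℝ) (q : T → Ω → ℝ)
    (hq : ∀ i, Measurable (q i)) (hb : ∀ i ω, |q i ω| ≤ 1)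
    (h0 : ∀ J ⊆ I, J.Nonempty → ∫ ω, ∏ j ∈ J, q j ω ∂P = 0) :
    ∫ ω, ∏ i ∈ I, (m i + q i ω) ∂P = ∏ i ∈ I, m i := by
  have hint : ∀ J : Finset T, Integrable (fun ω => ∏ j ∈ J, q j ω) P := fun J =>
    Integrable.of_bound (Finset.measurable_fun_prod J fun i _ => hq i).aestronglyMeasurable 1
      (ae_of_all _ fun ω => by
        rw [Real.norm_eq_abs, Finset.abs_prod]
        exact Finset.prod_le_one (fun i _ => abs_nonneg _) fun i _ => hb i ω)
  simp_rw [Finset.prod_add]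
  rw [integral_finsetSum _ fun J _ => (hint _).const_mul _]
  simp_rw [integral_const_mul]
  rw [Finset.sum_eq_single I]
  · simp
  · intro J hJ hne
    have hJ' := Finset.mem_powerset.1 hJ
    rw [h0 (I \ J) Finset.sdiff_subset, mul_zero]
    exact Finset.sdiff_nonempty.2 fun h => hne (hJ'.antisymm h)
  · simp

/-- A product of functions that live on events is split according to which of its factors has the
largest rank. -/
theorem prod_indicator_eq_sum {K : Type*} [LinearOrder K] (J : Finset T) (hJ : J.Nonempty)
    (G : T → Set Ω) (R : Ω → T → K) (q : T → Ω → ℝ)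
    (hR : ∀ ω i j, ω ∈ G i → ω ∈ G j → R ω i = R ω j → i = j) (ω : Ω) :
    ∏ j ∈ J, (G j).indicator (q j) ω =
      ∑ i ∈ J, {ω | ∀ j ∈ J, ω ∈ G j ∧ R ω j ≤ R ω i}.indicator (fun ω => ∏ j ∈ J, q j ω) ω := by
  by_cases hG : ∀ j ∈ J, ω ∈ G j
  · obtain ⟨i, hi, hmax⟩ := J.exists_max_image (R ω) hJ
    rw [Finset.sum_eq_single i]
    · rw [Set.indicator_of_mem (by exact fun j hj => ⟨hG j hj, hmax j hj⟩)]
      exact Finset.prod_congr rfl fun j hj => Set.indicator_of_mem (hG j hj) _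
    · intro b hb hbi
      refine Set.indicator_of_notMem (fun h => hbi ?_) _
      exact hR ω b i (hG b hb) (hG i hi) ((hmax b hb).antisymm (h i hi).2)
    · exact fun h => absurd hi h
  · push Not at hG
    obtain ⟨j, hj, hGj⟩ := hG
    rw [Finset.prod_eq_zero hj (Set.indicator_of_notMem hGj _), Finset.sum_eq_zero]
    exact fun i _ => Set.indicator_of_notMem (fun h => hGj (h j hj).1) _

end Expansion

/-! ### Replacing independent coordinates by explored ones -/

section Exploration

variable {E I₁ I₂ A B : Type*} [MeasurableSpace A] [MeasurableSpace B]

open Classical in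
/-- The coordinate `i` of `c` is replaced by the coordinate `e i` of `z` if `z` lies in `G i`. -/
noncomputable def explore (e : I₁ ⊕ I₂ → E) (G : I₁ ⊕ I₂ → Set ((E → A) × (E → B)))
    (p : ((E → A) × (E → B)) × ((I₁ → A) × (I₂ → B))) : (I₁ → A) × (I₂ → B) :=
  (fun i => if p.1 ∈ G (.inl i) then p.1.1 (e (.inl i)) else p.2.1 i,
    fun i => if p.1 ∈ G (.inr i) then p.1.2 (e (.inr i)) else p.2.2 i)

theorem measurable_explore {e : I₁ ⊕ I₂ → E} {G : I₁ ⊕ I₂ → Set ((E → A) × (E → B))}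
    (hG : ∀ i, MeasurableSet (G i)) : Measurable (explore e G) := by
  refine Measurable.prodMk (measurable_pi_lambda _ fun i => ?_)
    (measurable_pi_lambda _ fun i => ?_)
  · exact Measurable.ite (measurable_fst (hG _)) (by fun_prop) (by fun_prop)
  · exact Measurable.ite (measurable_fst (hG _)) (by fun_prop) (by fun_prop)

variable {K : Type*} [LinearOrder K] (e : I₁ ⊕ I₂ → E)
  (G : I₁ ⊕ I₂ → Set ((E → A) × (E → B))) (R : (E → A) × (E → B) → I₁ ⊕ I₂ → K)

/-- Which coordinates are revealed does not depend on their values: the events `G i` come with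
ranks `R`, and resampling the coordinate revealed by `i` affects neither `G j` nor the rank of `j`
for those `j` that are ranked up to `i`. -/
structure IsExploration : Prop where
  measurableSet : ∀ i, MeasurableSet (G i)
  measurableSet_le : ∀ i j, MeasurableSet {z | R z i ≤ R z j}
  rank_injective : ∀ z i j, z ∈ G i → z ∈ G j → R z i = R z j → i = j
  invariant : ∀ z z' i j, z ∈ G i → z ∈ G j → R z j ≤ R z i →
    (∀ ε, ε ≠ e i → z.1 ε = z'.1 ε ∧ z.2 ε = z'.2 ε) → z' ∈ G j ∧ R z' j = R z j
  -- Separate conditions for the two kinds of coordinates: an edge carries two marks, and both may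
  -- be used, each once.
  edge_injective_inl : ∀ z i j, z ∈ G (.inl i) → z ∈ G (.inl j) → e (.inl i) = e (.inl j) → i = j
  edge_injective_inr : ∀ z i j, z ∈ G (.inr i) → z ∈ G (.inr j) → e (.inr i) = e (.inr j) → i = j

variable {e G R} (μ : E → Measure A) (ρ : E → Measure B)
  [∀ i, IsProbabilityMeasure (μ i)] [∀ i, IsProbabilityMeasure (ρ i)]

-- On the event that all of `J` is revealed and `i` comes last, a resampling of the mark read by `i`
-- preserves the event and, by the injectivity conditions, all other factors. The factor of `i` is
-- centred, so this event contributes zero.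
open Classical in
theorem IsExploration.integral_prod_indicator_eq_zero (h : IsExploration e G R)
    (f : I₁ → A → ℝ) (g : I₂ → B → ℝ) (hf : ∀ i, Measurable (f i)) (hg : ∀ i, Measurable (g i))
    (hfb : ∀ i x, |f i x| ≤ 1) (hgb : ∀ i x, |g i x| ≤ 1)
    (hf0 : ∀ i, ∫ x, f i x ∂μ (e (.inl i)) = 0) (hg0 : ∀ i, ∫ x, g i x ∂ρ (e (.inr i)) = 0)
    (J : Finset (I₁ ⊕ I₂)) (hJ : J.Nonempty) :
    ∫ z, ∏ j ∈ J, (G j).indicator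
      (Sum.elim (fun i (z : (E → A) × (E → B)) => f i (z.1 (e (.inl i))))
        (fun i z => g i (z.2 (e (.inr i)))) j) z
      ∂((Measure.infinitePi μ).prod (Measure.infinitePi ρ)) = 0 := by
  set q : I₁ ⊕ I₂ → (E → A) × (E → B) → ℝ :=
    Sum.elim (fun i (z : (E → A) × (E → B)) => f i (z.1 (e (.inl i))))
        (fun i z => g i (z.2 (e (.inr i)))) with hqdef
  have hq : ∀ j, Measurable (q j) := by
    rintro (j | j)
    · exact (hf j).comp (by fun_prop)
    · exact (hg j).comp (by fun_prop)
  have hqb : ∀ j z, |q j z| ≤ 1 := by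
    rintro (j | j) z
    · exact hfb _ _
    · exact hgb _ _
  set D : I₁ ⊕ I₂ → Set ((E → A) × (E → B)) := fun i => {z | ∀ j ∈ J, z ∈ G j ∧ R z j ≤ R z i}
    with hDdef
  have hD : ∀ i, MeasurableSet (D i) := fun i => by
    have : D i = ⋂ j ∈ J, (G j ∩ {z | R z j ≤ R z i}) := by ext z; simp [hDdef]
    rw [this]
    exact Finset.measurableSet_biInter J fun j _ =>
      (h.measurableSet j).inter (h.measurableSet_le j i)
  have hDinv : ∀ z z' i, i ∈ J → (∀ ε, ε ≠ e i → z.1 ε = z'.1 ε ∧ z.2 ε = z'.2 ε) →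
      z ∈ D i → z' ∈ D i := by
    intro z z' i hi hzz hz j hj
    have h1 := h.invariant z z' i j (hz i hi).1 (hz j hj).1 (hz j hj).2 hzz
    have h2 := h.invariant z z' i i (hz i hi).1 (hz i hi).1 le_rfl hzz
    exact ⟨h1.1, by rw [h1.2, h2.2]; exact (hz j hj).2⟩
  simp_rw [prod_indicator_eq_sum J hJ G R q h.rank_injective]
  have hint : ∀ i ∈ J, Integrable ((D i).indicator fun z => ∏ j ∈ J, q j z)
      ((Measure.infinitePi μ).prod (Measure.infinitePi ρ)) := fun i _ =>
    (Integrable.of_bound (Finset.measurable_fun_prod J fun i _ => hq i).aestronglyMeasurable 1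
      (ae_of_all _ fun ω => by
        rw [Real.norm_eq_abs, Finset.abs_prod]
        exact Finset.prod_le_one (fun i _ => abs_nonneg _) fun i _ => hqb i ω)).indicator (hD i)
  rw [integral_finsetSum _ hint]
  refine Finset.sum_eq_zero fun i hi => ?_
  have hsplit : ∀ z, (D i).indicator (fun z => ∏ j ∈ J, q j z) z =
      (D i).indicator (fun z => ∏ j ∈ J.erase i, q j z) z * q i z := by
    intro z
    by_cases hz : z ∈ D i
    · simp only [Set.indicator_of_mem hz, Finset.prod_erase_mul J _ hi]
    · simp [Set.indicator_of_notMem hz]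
  have hhm : Measurable ((D i).indicator (fun z => ∏ j ∈ J.erase i, q j z)) :=
    (Finset.measurable_fun_prod _ fun i _ => hq i).indicator (hD i)
  have hhinv : ∀ z z', (∀ ε, ε ≠ e i → z.1 ε = z'.1 ε ∧ z.2 ε = z'.2 ε) →
      (z ∈ D i → ∀ j ∈ J.erase i, q j z' = q j z) →
      (D i).indicator (fun z => ∏ j ∈ J.erase i, q j z) z' =
      (D i).indicator (fun z => ∏ j ∈ J.erase i, q j z) z := by
    intro z z' hzz hqq
    by_cases hz : z ∈ D i
    · rw [Set.indicator_of_mem hz, Set.indicator_of_mem (hDinv z z' i hi hzz hz)]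
      exact Finset.prod_congr rfl (hqq hz)
    · rw [Set.indicator_of_notMem hz, Set.indicator_of_notMem]
      -- Invariance is also needed backwards: resampling must not create the event either.
      exact fun hz' => hz (hDinv z' z i hi (fun ε hε => ⟨(hzz ε hε).1.symm, (hzz ε hε).2.symm⟩) hz')
  change ∫ z, (D i).indicator (fun z => ∏ j ∈ J, q j z) z ∂_ = 0
  simp_rw [hsplit]
  rcases i with i | i
  · refine integral_mul_eq_zero_of_resample (measurePreserving_update_fst μ ρ (e (.inl i)))
      hhm (hq _) (fun p => hhinv _ _ ?_ ?_) (g := f i) ?_ (hf0 i)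
    · intro ε hε
      simp [Function.update_of_ne hε]
    · rintro hz (j | j) hj
      · have : e (.inl j) ≠ e (.inl i) := fun he => (Finset.mem_erase.1 hj).1 <| congrArg _ <|
          h.edge_injective_inl p.1 j i (hz _ (Finset.mem_of_mem_erase hj)).1 (hz _ hi).1 he
        simp [hqdef, Function.update_of_ne this]
      · simp [hqdef]
    · simp [hqdef]
  · refine integral_mul_eq_zero_of_resample (measurePreserving_update_snd μ ρ (e (.inr i)))
      hhm (hq _) (fun p => hhinv _ _ ?_ ?_) (g := g i) ?_ (hg0 i)
    · intro ε hε
      simp [Function.update_of_ne hε]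
    · rintro hz (j | j) hj
      · simp [hqdef]
      · have : e (.inr j) ≠ e (.inr i) := fun he => (Finset.mem_erase.1 hj).1 <| congrArg _ <|
          h.edge_injective_inr p.1 j i (hz _ (Finset.mem_of_mem_erase hj)).1 (hz _ hi).1 he
        simp [hqdef, Function.update_of_ne this]
    · simp [hqdef]

end Exploration

/-! ### Exploration preserves the product law -/

section Exploration

variable {E I₁ I₂ A B K : Type*} [MeasurableSpace A] [MeasurableSpace B] [LinearOrder K]
  {e : I₁ ⊕ I₂ → E} {G : I₁ ⊕ I₂ → Set ((E → A) × (E → B))}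
  {R : (E → A) × (E → B) → I₁ ⊕ I₂ → K} (μ : E → Measure A) (ρ : E → Measure B)
  [∀ i, IsProbabilityMeasure (μ i)] [∀ i, IsProbabilityMeasure (ρ i)]

-- The conditional probability that one coordinate falls into `a` is 0 or 1 if it is revealed and `m
-- a` otherwise; the right-hand side separates the mean from a centred perturbation.
open Classical in
theorem measure_ite_eq_ofReal {S : Type*} [MeasurableSpace S] (m : Measure S)
    [IsProbabilityMeasure m] (a : Set S) (x : S) (p : Prop) :
    m (if p then (if x ∈ a then Set.univ else ∅) else a) =
      ENNReal.ofReal (m.real a + if p then a.indicator 1 x - m.real a else 0) := by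
  by_cases hp : p
  · by_cases hx : x ∈ a <;> simp [hp, hx]
  · simp [hp]

theorem integral_indicator_sub_measureReal {S : Type*} [MeasurableSpace S] (m : Measure S)
    [IsProbabilityMeasure m] {a : Set S} (ha : MeasurableSet a) :
    ∫ x, (a.indicator 1 x - m.real a) ∂m = 0 := by
  rw [integral_sub ((integrable_indicator_iff ha).2 (integrable_const 1).integrableOn)
    (integrable_const _), integral_indicator_one ha]
  simp

theorem abs_indicator_sub_measureReal_le {S : Type*} [MeasurableSpace S] (m : Measure S)
    [IsProbabilityMeasure m] (a : Set S) (x : S) : |a.indicator 1 x - m.real a| ≤ 1 := by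
  have h0 : 0 ≤ m.real a := measureReal_nonneg
  have h1 : m.real a ≤ 1 := measureReal_le_one
  by_cases hx : x ∈ a
  · simp only [hx, Set.indicator_of_mem, Pi.one_apply]
    rw [abs_le]; constructor <;> linarith
  · simp only [hx, not_false_eq_true, Set.indicator_of_notMem]
    rw [abs_le]; constructor <;> linarith

open Classical in
/-- Replacing independent coordinates by explored ones with the same law does not change the
joint law. -/
theorem IsExploration.map_explore (h : IsExploration e G R) :
    (((Measure.infinitePi μ).prod (Measure.infinitePi ρ)).prod
      ((Measure.infinitePi fun i => μ (e (.inl i))).prod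
        (Measure.infinitePi fun i => ρ (e (.inr i))))).map (explore e G) =
      (Measure.infinitePi fun i => μ (e (.inl i))).prod
        (Measure.infinitePi fun i => ρ (e (.inr i))) := by
  refine (prod_infinitePi_eq_of_boxes _ _ fun s t a b ha hb => ?_).symm
  have hmeas := measurable_explore (e := e) h.measurableSet
  have hbox : MeasurableSet ((s : Set I₁).pi a ×ˢ (t : Set I₂).pi b) :=
    (MeasurableSet.pi s.countable_toSet fun i _ => ha i).prod
      (MeasurableSet.pi t.countable_toSet fun i _ => hb i)
  rw [Measure.map_apply hmeas hbox, Measure.prod_apply (hmeas hbox)]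
  set m : I₁ ⊕ I₂ → ℝ := Sum.elim (fun i => (μ (e (.inl i))).real (a i))
    (fun i => (ρ (e (.inr i))).real (b i)) with hm
  set q : I₁ ⊕ I₂ → (E → A) × (E → B) → ℝ := fun j => (G j).indicator
      (Sum.elim (fun i (z : (E → A) × (E → B)) =>
          (a i).indicator 1 (z.1 (e (.inl i))) - (μ (e (.inl i))).real (a i))
        (fun i z => (b i).indicator 1 (z.2 (e (.inr i))) - (ρ (e (.inr i))).real (b i)) j) with hq
  have hf : ∀ i, Measurable fun x => (a i).indicator 1 x - (μ (e (.inl i))).real (a i) := fun i =>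
    ((measurable_indicator_const_iff (1 : ℝ)).2 (ha i)).sub_const _
  have hg : ∀ i, Measurable fun x => (b i).indicator 1 x - (ρ (e (.inr i))).real (b i) := fun i =>
    ((measurable_indicator_const_iff (1 : ℝ)).2 (hb i)).sub_const _
  have hqm : ∀ j, Measurable (q j) := by
    rintro (j | j)
    · exact Measurable.indicator ((hf j).comp (by fun_prop)) (h.measurableSet _)
    · exact Measurable.indicator ((hg j).comp (by fun_prop)) (h.measurableSet _)
  have hqb : ∀ j z, |q j z| ≤ 1 := by
    intro j z
    by_cases hz : z ∈ G j
    · simp only [hq, Set.indicator_of_mem hz]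
      rcases j with j | j <;> exact abs_indicator_sub_measureReal_le _ _ _
    · simp [hq, Set.indicator_of_notMem hz]
  have hnn : ∀ j z, 0 ≤ m j + q j z := by
    intro j z
    by_cases hz : z ∈ G j
    · simp only [hm, hq, Set.indicator_of_mem hz]
      rcases j with j | j <;> simp [Set.indicator_nonneg]
    · simp only [hm, hq, Set.indicator_of_notMem hz]
      rcases j with j | j <;> simp
  -- For fixed marks the section of a box is again a box in the reservoir: revealed sides become
  -- everything or nothing, the others stay.
  have hsec : ∀ z, ((Measure.infinitePi fun i => μ (e (.inl i))).prod
        (Measure.infinitePi fun i => ρ (e (.inr i))))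
        (Prod.mk z ⁻¹' (explore e G ⁻¹' ((s : Set I₁).pi a ×ˢ (t : Set I₂).pi b))) =
      ENNReal.ofReal (∏ j ∈ s.disjSum t, (m j + q j z)) := by
    intro z
    have : Prod.mk z ⁻¹' (explore e G ⁻¹' ((s : Set I₁).pi a ×ˢ (t : Set I₂).pi b)) =
        ((s : Set I₁).pi fun i => if z ∈ G (.inl i) then
            (if z.1 (e (.inl i)) ∈ a i then Set.univ else ∅) else a i) ×ˢ
          ((t : Set I₂).pi fun i => if z ∈ G (.inr i) then
            (if z.2 (e (.inr i)) ∈ b i then Set.univ else ∅) else b i) := by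
      ext c
      simp only [Set.mem_preimage, Set.mem_prod, Set.mem_pi, explore]
      refine and_congr (forall₂_congr fun i _ => ?_) (forall₂_congr fun i _ => ?_)
      all_goals split_ifs <;> simp_all
    rw [this, Measure.prod_prod, Measure.infinitePi_pi, Measure.infinitePi_pi,
      ENNReal.ofReal_prod_of_nonneg fun j _ => hnn j z, Finset.prod_disjSum]
    · refine congrArg₂ _ (Finset.prod_congr rfl fun i _ => ?_)
        (Finset.prod_congr rfl fun i _ => ?_)
      · rw [measure_ite_eq_ofReal]
        simp [hm, hq, Set.indicator_apply]
      · rw [measure_ite_eq_ofReal]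
        simp [hm, hq, Set.indicator_apply]
    · intro i _
      split_ifs
      exacts [.univ, .empty, hb i]
    · intro i _
      split_ifs
      exacts [.univ, .empty, ha i]
  have hmb : ∀ j, |m j| ≤ 1 := by
    rintro (j | j)
    · simp [hm, abs_of_nonneg measureReal_nonneg]
    · simp [hm, abs_of_nonneg measureReal_nonneg]
  have hprodm : Measurable fun z => ∏ j ∈ s.disjSum t, (m j + q j z) :=
    Finset.measurable_fun_prod _ fun j _ => (hqm j).const_add _
  have hint : Integrable (fun z => ∏ j ∈ s.disjSum t, (m j + q j z))
      ((Measure.infinitePi μ).prod (Measure.infinitePi ρ)) := by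
    refine Integrable.of_bound hprodm.aestronglyMeasurable (∏ j ∈ s.disjSum t, (2 : ℝ))
      (ae_of_all _ fun z => ?_)
    rw [Real.norm_eq_abs, Finset.abs_prod]
    refine Finset.prod_le_prod (fun i _ => abs_nonneg _) fun j _ => (abs_add_le _ _).trans ?_
    linarith [hmb j, hqb j z]
  simp_rw [hsec]
  rw [← ofReal_integral_eq_lintegral_ofReal hint
      (ae_of_all _ fun z => Finset.prod_nonneg fun j _ => hnn j z),
    integral_prod_const_add _ m q hqm hqb, Finset.prod_disjSum, ENNReal.ofReal_mul,
    ENNReal.ofReal_prod_of_nonneg, ENNReal.ofReal_prod_of_nonneg]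
  · simp [hm]
  · exact fun i _ => measureReal_nonneg
  · exact fun i _ => measureReal_nonneg
  · exact Finset.prod_nonneg fun i _ => measureReal_nonneg
  · intro J _ hJ
    exact h.integral_prod_indicator_eq_zero μ ρ _ _ hf hg
      (fun i x => abs_indicator_sub_measureReal_le _ _ _)
      (fun i x => abs_indicator_sub_measureReal_le _ _ _)
      (fun i => integral_indicator_sub_measureReal _ (ha i))
      (fun i => integral_indicator_sub_measureReal _ (hb i)) J hJ

end Exploration

variable {d : ℕ}

/-! ### Paths as lists of sites -/

/-- For each unordered pair of sites, a number of connections and an edge-weight. -/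
abbrev EdgeMarks (d : ℕ) := (Sym2 (Site d) → ℕ) × (Sym2 (Site d) → ℝ)

/-- The end of the path that starts at `0` and visits the sites of the list in reverse order. -/
def tip : List (Site d) → Site d
  | [] => 0
  | y :: _ => y

/-- All steps of the path are along connected pairs of distinct sites. -/
def IsOpen (c : EdgeMarks d) : List (Site d) → Prop
  | [] => True
  | y :: l => (1 ≤ c.1 s(tip l, y) ∧ tip l ≠ y) ∧ IsOpen c l

/-- The length of the path with respect to the positive parts of the edge-weights. -/
noncomputable def cost (c : EdgeMarks d) : List (Site d) → ℝ
  | [] => 0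
  | y :: l => cost c l + max (c.2 s(tip l, y)) 0

/-- Paths are ordered by their length, then by their number of edges, then lexicographically. -/
noncomputable def pathKey (e : Site d ↪ ℕ) (c : EdgeMarks d) (l : List (Site d)) :
    ℝ ×ₗ ℕ ×ₗ List ℕ :=
  toLex (cost c l, toLex (l.length, (0 :: l.reverse).map e))

/-- `l` is the first open path in the order of paths that ends in one of the two sites of `ε`. -/
def Leading (e : Site d ↪ ℕ) (c : EdgeMarks d) (ε : Sym2 (Site d)) (l : List (Site d)) : Prop :=
  IsOpen c l ∧ tip l ∈ ε ∧ ∀ b, IsOpen c b → tip b ∈ ε → pathKey e c l ≤ pathKey e c b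

theorem pathKey_injective (e : Site d ↪ ℕ) (c : EdgeMarks d) :
    Function.Injective (pathKey e c) := by
  intro l b h
  have h1 : (0 :: l.reverse).map e = (0 :: b.reverse).map e :=
    congrArg (fun k : ℝ ×ₗ ℕ ×ₗ List ℕ => (ofLex (ofLex k).2).2) h
  simpa using List.map_injective_iff.2 e.injective h1

/-- Positive parts in `cost` make length monotone for every sample, and the number of edges makes
the increase strict even along edges of weight zero. -/
theorem pathKey_lt_cons (e : Site d ↪ ℕ) (c : EdgeMarks d) (y : Site d) (l : List (Site d)) :
    pathKey e c l < pathKey e c (y :: l) := by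
  have h : cost c l ≤ cost c (y :: l) := le_add_of_nonneg_right (le_max_right _ _)
  rcases h.lt_or_eq with h | h
  · exact Prod.Lex.toLex_lt_toLex.2 (.inl h)
  · exact Prod.Lex.toLex_lt_toLex.2 (.inr ⟨h, Prod.Lex.toLex_lt_toLex.2 (.inl (by simp))⟩)

theorem pathKey_cons_lt_cons {e : Site d ↪ ℕ} {c : EdgeMarks d} {l b : List (Site d)} (y : Site d)
    (htip : tip l = tip b) (h : pathKey e c l < pathKey e c b) :
    pathKey e c (y :: l) < pathKey e c (y :: b) := by
  unfold pathKey at h ⊢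
  rw [Prod.Lex.toLex_lt_toLex, Prod.Lex.toLex_lt_toLex] at h ⊢
  simp only [cost, htip, List.length_cons, List.reverse_cons, add_lt_add_iff_right,
    add_left_inj] at h ⊢
  refine h.imp id fun h => ⟨h.1, h.2.imp id fun h => ⟨h.1, ?_⟩⟩
  -- Lists of sites are compared only after a tie in the number of edges; for equal lengths,
  -- appending a common last entry preserves the strict lexicographic order.
  have key : ∀ (u v : List ℕ) (n : ℕ), u.length = v.length → u < v → u ++ [n] < v ++ [n] := by
    intro u v n huv hlt
    induction hlt with
    | nil => simp at huv
    | rel h => exact List.Lex.rel h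
    | cons _ ih => exact List.Lex.cons (ih (by simpa using huv))
  have := key _ _ (e y) (by simp [h.1]) h.2
  simpa using this

/-- An open path either does not use the edge `ε`, or it passes a site of `ε` before. -/
theorem IsOpen.congr_or_exists_lt (e : Site d ↪ ℕ) {c c' : EdgeMarks d} {ε : Sym2 (Site d)}
    (hc : ∀ ε', ε' ≠ ε → c.1 ε' = c'.1 ε' ∧ c.2 ε' = c'.2 ε') {l : List (Site d)}
    (hl : IsOpen c l) :
    (IsOpen c' l ∧ pathKey e c' l = pathKey e c l) ∨
      ∃ b, IsOpen c b ∧ IsOpen c' b ∧ tip b ∈ ε ∧ pathKey e c' b = pathKey e c b ∧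
        pathKey e c b < pathKey e c l := by
  induction l with
  | nil => exact .inl ⟨trivial, rfl⟩
  | cons y l ih =>
    rcases ih hl.2 with ⟨h1, h2⟩ | ⟨b, hb1, hb2, hb3, hb4, hb5⟩
    · by_cases hε : s(tip l, y) = ε
      -- At the first use of `ε`, the piece before it ends in `ε` and is unaffected by the change.
      · exact .inr ⟨l, hl.2, h1, hε ▸ Sym2.mem_mk_left _ _, h2, pathKey_lt_cons e c y l⟩
      · obtain ⟨k1, k2⟩ := hc _ hε
        have hcost : cost c' l = cost c l :=
          congrArg (fun k : ℝ ×ₗ ℕ ×ₗ List ℕ => (ofLex k).1) h2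
        exact .inl ⟨⟨⟨k1 ▸ hl.1.1, hl.1.2⟩, h1⟩, by simp only [pathKey, cost, hcost, k2]⟩
    · exact .inr ⟨b, hb1, hb2, hb3, hb4, hb5.trans (pathKey_lt_cons e c y l)⟩

/-- If `l` is the first path that reaches `ε`, then changing `ε` does not affect the paths up to
`l` that are the first ones to reach an edge. -/
theorem Leading.congr {e : Site d ↪ ℕ} {c c' : EdgeMarks d} {ε ε' : Sym2 (Site d)}
    {l l' : List (Site d)} (hl : Leading e c ε l) (hl' : Leading e c ε' l')
    (hle : pathKey e c l' ≤ pathKey e c l)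
    (hc : ∀ η, η ≠ ε → c.1 η = c'.1 η ∧ c.2 η = c'.2 η) :
    Leading e c' ε' l' ∧ pathKey e c' l' = pathKey e c l' := by
  have hc' : ∀ η, η ≠ ε → c'.1 η = c.1 η ∧ c'.2 η = c.2 η :=
    fun η h => ⟨(hc η h).1.symm, (hc η h).2.symm⟩
  rcases hl'.1.congr_or_exists_lt e hc with ⟨h1, h2⟩ | ⟨b, hb1, -, hb3, -, hb5⟩
  · refine ⟨⟨h1, hl'.2.1, fun b hb hbε => ?_⟩, h2⟩
    rw [h2]
    rcases hb.congr_or_exists_lt e hc' with ⟨k1, k2⟩ | ⟨b', k1, k2, k3, k4, k5⟩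
    · exact k2 ▸ hl'.2.2 b k1 hbε
    -- A competitor `b` that uses `ε` first reaches it by `b'`, which is also open in `c` and hence
    -- not before `l`.
    · exact hle.trans ((hl.2.2 b' k2 k3).trans (k4 ▸ k5.le))
  · exact absurd (hl.2.2 b hb1 hb3) (not_le.2 (hb5.trans_le hle))

theorem Leading.unique {e : Site d ↪ ℕ} {c : EdgeMarks d} {ε : Sym2 (Site d)}
    {l l' : List (Site d)} (hl : Leading e c ε l) (hl' : Leading e c ε l') : l = l' :=
  pathKey_injective e c ((hl.2.2 l' hl'.1 hl'.2.1).antisymm (hl'.2.2 l hl.1 hl.2.1))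

theorem measurableSet_isOpen (l : List (Site d)) :
    MeasurableSet {c : EdgeMarks d | IsOpen c l} := by
  induction l with
  | nil => exact .const True
  | cons y l ih =>
    refine MeasurableSet.inter (MeasurableSet.inter ?_ (.const _)) ih
    exact measurableSet_le (f := fun _ : EdgeMarks d => 1) (g := fun c => c.1 s(tip l, y))
      measurable_const (by fun_prop)

theorem measurable_cost (l : List (Site d)) : Measurable fun c : EdgeMarks d => cost c l := by
  induction l with
  | nil => exact measurable_const
  | cons y l ih => exact ih.add (Measurable.max (by fun_prop) measurable_const)

theorem measurableSet_pathKey_le (e : Site d ↪ ℕ) (l b : List (Site d)) :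
    MeasurableSet {c : EdgeMarks d | pathKey e c l ≤ pathKey e c b} := by
  simp only [pathKey, Prod.Lex.toLex_le_toLex (x := (_ : ℝ × _))]
  exact (measurableSet_lt (measurable_cost l) (measurable_cost b)).union
    ((measurableSet_eq_fun (measurable_cost l) (measurable_cost b)).inter (.const _))

theorem measurableSet_leading (e : Site d ↪ ℕ) (ε : Sym2 (Site d)) (l : List (Site d)) :
    MeasurableSet {c : EdgeMarks d | Leading e c ε l} := by
  have : {c : EdgeMarks d | Leading e c ε l} = {c | IsOpen c l} ∩ ({_c | tip l ∈ ε} ∩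
      ⋂ b : List (Site d), ({c | IsOpen c b}ᶜ ∪ ({_c | tip b ∈ ε}ᶜ ∪
        {c | pathKey e c l ≤ pathKey e c b}))) := by
    ext c
    simp only [Leading, Set.mem_ofPred_eq, Set.mem_inter_iff, Set.mem_iInter, Set.mem_union,
      Set.mem_compl_iff, imp_iff_not_or]
  rw [this]
  exact (measurableSet_isOpen l).inter ((MeasurableSet.const _).inter (.iInter fun b =>
    (measurableSet_isOpen b).compl.union ((MeasurableSet.const _).compl.union
      (measurableSet_pathKey_le e l b))))

/-! ### The exploration of the shortest-path tree -/

/-- The offspring numbers and the edge-weights of a branching random walk. -/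
abbrev BRWCoord (d : ℕ) := (Indiv d × Site d) ⊕ Indiv d

namespace BRWCoord

/-- The individual whose offspring is described by the coordinate. -/
def parent : BRWCoord d → Indiv d
  | .inl (a, _) => a
  | .inr [] => []
  | .inr (_ :: a) => a

/-- The pair of the locations of the parent and the child. -/
def edge : BRWCoord d → Sym2 (Site d)
  | .inl (a, y) => s(Indiv.site a, y)
  | .inr [] => s(0, 0)
  | .inr ((y, _) :: a) => s(Indiv.site a, y)

/-- The coordinate may be identified with a mark of an edge of the percolation graph: all children
involved have number `0`. -/
def Primary : BRWCoord d → Prop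
  | .inl (a, _) => ∀ m ∈ a, m.2 = 0
  | .inr [] => False
  | .inr (b :: a) => b.2 = 0 ∧ ∀ m ∈ a, m.2 = 0

/-- With all numbers equal to 0, the parent can be recovered from her ancestral sites; together with
`Leading.unique` this shows that an edge is claimed by only one parent. -/
theorem Primary.parent_eq : ∀ {i : BRWCoord d}, i.Primary →
    i.parent = (i.parent.map Prod.fst).map fun y => (y, 0) := by
  have key : ∀ a : Indiv d, (∀ m ∈ a, m.2 = 0) → a = (a.map Prod.fst).map fun y => (y, 0) := by
    intro a ha
    rw [List.map_map]
    exact (List.map_id a).symm.trans (List.map_congr_left fun m hm => Prod.ext rfl (ha m hm))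
  rintro (⟨a, y⟩ | _ | ⟨b, a⟩) h
  · exact key a h
  · exact h.elim
  · exact key a h.2

/-- The coordinate is revealed by the exploration of the percolation graph. -/
def revealed (e : Site d ↪ ℕ) (i : BRWCoord d) : Set (EdgeMarks d) :=
  {c | i.Primary ∧ Leading e c i.edge (i.parent.map Prod.fst)}

/-- The order in which the exploration reveals the coordinates. -/
noncomputable def rank (e : Site d ↪ ℕ) (c : EdgeMarks d) (i : BRWCoord d) :
    (ℝ ×ₗ ℕ ×ₗ List ℕ) ×ₗ ℕ :=
  toLex (pathKey e c (i.parent.map Prod.fst), Encodable.encode i)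

/-- Uniqueness of the leading path prevents an edge from being used twice, in particular in both
directions; `Leading.congr` gives the invariance. The encoding in `rank` only separates coordinates
whose parents have the same path. -/
theorem isExploration (e : Site d ↪ ℕ) :
    IsExploration (edge (d := d)) (revealed e) (rank e) where
  measurableSet i := (MeasurableSet.const _).inter (measurableSet_leading e _ _)
  measurableSet_le i j := by
    simp only [rank, Prod.Lex.toLex_le_toLex (x := (_ : (ℝ ×ₗ ℕ ×ₗ List ℕ) × ℕ)),
      lt_iff_le_not_ge, le_antisymm_iff (a := pathKey e _ _)]
    exact ((measurableSet_pathKey_le e _ _).inter (measurableSet_pathKey_le e _ _).compl).union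
      (((measurableSet_pathKey_le e _ _).inter (measurableSet_pathKey_le e _ _)).inter (.const _))
  rank_injective c i j _ _ h :=
    Encodable.encode_injective (congrArg (fun k => (ofLex k).2) h)
  invariant c c' i j hi hj hle hc := by
    have hle' : pathKey e c ((parent j).map Prod.fst) ≤
        pathKey e c ((parent i).map Prod.fst) :=
      Prod.Lex.monotone_fst _ _ hle
    obtain ⟨h1, h2⟩ := hi.2.congr hj.2 hle' hc
    exact ⟨⟨hj.1, h1⟩, by rw [rank, h2, rank]⟩
  edge_injective_inl := by
    rintro c ⟨a, y⟩ ⟨a', y'⟩ hi hj h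
    have h1 : a = a' := by
      have := hi.1.parent_eq
      rw [hi.2.unique (h ▸ hj.2)] at this
      exact this.trans hj.1.parent_eq.symm
    subst h1
    exact congrArg _ (Sym2.congr_right.1 h)
  edge_injective_inr := by
    rintro c (_ | ⟨⟨y, k⟩, a⟩) (_ | ⟨⟨y', k'⟩, a'⟩) hi hj h
    · rfl
    · exact hi.1.elim
    · exact hj.1.elim
    · have h1 : a = a' := by
        have := hi.1.parent_eq
        rw [hi.2.unique (h ▸ hj.2)] at this
        exact this.trans hj.1.parent_eq.symm
      subst h1
      have hk : k = 0 := hi.1.1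
      have hk' : k' = 0 := hj.1.1
      rw [Sym2.congr_right.1 h, hk, hk']

end BRWCoord

/-! ### The three processes as functions of the marks -/

/-- The percolation configuration: an edge is present if there is at least one connection. -/
def toEdgeConf (c : EdgeMarks d) : EdgeConf d :=
  (fun ε => decide (1 ≤ c.1 ε), c.2)

/-- The branching random walk that keeps one child at every site. -/
def thin (p : BRWConf d) : BRWConf d :=
  (fun i => min 1 (p.1 i), p.2)

theorem isThinning_thin (p : BRWConf d) : IsThinning (thin p) p :=
  ⟨fun _ _ _ => rfl, fun _ _ => rfl⟩

theorem born_of_born_thin {p : BRWConf d} : ∀ {a : Indiv d}, Born (thin p) a → Born p a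
  | [], _ => trivial
  | (_, _) :: _, h => ⟨h.1.trans_le (min_le_right _ _), born_of_born_thin h.2⟩

theorem rootDist_thin (p : BRWConf d) : ∀ a : Indiv d, rootDist (thin p) a = rootDist p a
  | [] => rfl
  | b :: a => congrArg (· + p.2 (b :: a)) (rootDist_thin p a)

theorem brwBall_thin_isSubgraphVia (w : Env d) (p : BRWConf d) (t : ℝ) :
    (brwBall w (thin p) t).IsSubgraphVia id (brwBall w p t) := by
  have key : ∀ a : Indiv d, Born (thin p) a ∧ rootDist (thin p) a ≤ t →
      Born p a ∧ rootDist p a ≤ t := fun a h =>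
    ⟨born_of_born_thin h.1, rootDist_thin p a ▸ h.2⟩
  exact
    { map_root := rfl
      mapsTo := fun a h => key a h
      injOn := Function.injective_id.injOn
      map_loc := fun _ _ => rfl
      map_vertexWeight := fun _ _ => rfl
      map_edge := fun a b h => ⟨key a h.1, key b h.2.1, h.2.2⟩
      map_edgeWeight := fun _ _ _ => rfl }

/-! ### Walks and lists of sites -/

theorem toEdgeConf_adj {c : EdgeMarks d} {x y : Site d} :
    (sfpGraph (toEdgeConf c)).Adj x y ↔ 1 ≤ c.1 s(x, y) ∧ x ≠ y := by
  simp [sfpGraph, toEdgeConf]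

theorem lLength_cons (s : EdgeConf d) {x y z : Site d} (h : (sfpGraph s).Adj x y)
    (p : (sfpGraph s).Walk y z) : lLength s (.cons h p) = s.2 s(x, y) + lLength s p :=
  List.sum_cons

theorem lLength_reverse (s : EdgeConf d) {x y : Site d} (p : (sfpGraph s).Walk x y) :
    lLength s p.reverse = lLength s p := by
  simp [lLength, SimpleGraph.Walk.edges_reverse, List.sum_reverse]

/-- Walks are taken towards the origin so that their first step matches the head of the list;
suffixes of the list then are initial pieces of the path from the origin. The endpoint `o` is kept
variable for the induction. -/
theorem exists_list_of_walk {c : EdgeMarks d} (hc : ∀ ε, 0 ≤ c.2 ε) {z o : Site d}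
    (q : (sfpGraph (toEdgeConf c)).Walk z o) (ho : o = 0) :
    ∃ l, IsOpen c l ∧ tip l = z ∧ cost c l = lLength _ q ∧ q.support = l ++ [0] ∧
      (∀ x ∈ q.support, ∃ l', l' <:+ l ∧ tip l' = x) ∧
      ∀ x y, (x, y) ∈ q.darts.map SimpleGraph.Dart.toProd → ∃ l', x :: l' <:+ l ∧ tip l' = y := by
  induction q with
  | nil => subst ho; exact ⟨[], trivial, rfl, rfl, rfl, by simp [tip], by simp⟩
  | @cons z y o h q ih =>
    obtain ⟨l, h1, h2, h3, h4, h5, h6⟩ := ih ho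
    have hadj := toEdgeConf_adj.1 h.symm
    refine ⟨z :: l, ⟨h2 ▸ hadj, h1⟩, rfl, ?_, by simp [h4], ?_, ?_⟩
    · rw [cost, h2, h3, max_eq_left (hc _), Sym2.eq_swap, add_comm, lLength_cons]
      rfl
    · intro x hx
      rcases List.mem_cons.1 (SimpleGraph.Walk.support_cons h q ▸ hx) with rfl | hx
      · exact ⟨x :: l, List.suffix_rfl, rfl⟩
      · obtain ⟨l', k1, k2⟩ := h5 x hx
        exact ⟨l', k1.trans (List.suffix_cons _ _), k2⟩
    · intro x y' hx
      rw [SimpleGraph.Walk.darts_cons, List.map_cons, List.mem_cons] at hx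
      rcases hx with hx | hx
      · obtain ⟨rfl, rfl⟩ := Prod.ext_iff.1 hx
        exact ⟨l, List.suffix_rfl, h2⟩
      · obtain ⟨l', k1, k2⟩ := h6 x y' hx
        exact ⟨l', k1.trans (List.suffix_cons _ _), k2⟩

theorem exists_walk_of_list {c : EdgeMarks d} (hc : ∀ ε, 0 ≤ c.2 ε) {l : List (Site d)}
    (hl : IsOpen c l) : ∃ q : (sfpGraph (toEdgeConf c)).Walk (tip l) 0,
      lLength _ q = cost c l ∧ q.support = l ++ [0] := by
  induction l with
  | nil => exact ⟨.nil, rfl, rfl⟩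
  | cons y l ih =>
    obtain ⟨q, h1, h2⟩ := ih hl.2
    have hadj : (sfpGraph (toEdgeConf c)).Adj y (tip l) := (toEdgeConf_adj.2 hl.1).symm
    have : ∃ q : (sfpGraph (toEdgeConf c)).Walk y 0,
        lLength _ q = cost c (y :: l) ∧ q.support = y :: l ++ [0] := by
      refine ⟨.cons hadj q, ?_, by simp [h2]⟩
      rw [cost, ← h1, max_eq_left (hc _), Sym2.eq_swap, add_comm, lLength_cons]
      rfl
    exact this

/-! ### Minimal paths -/

/-- `l` is the first open path to its end in the order of paths. -/
def IsMinimal (e : Site d ↪ ℕ) (c : EdgeMarks d) (l : List (Site d)) : Prop :=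
  IsOpen c l ∧ ∀ b, IsOpen c b → tip b = tip l → pathKey e c l ≤ pathKey e c b

/-- A better path to `tip l` could be extended to `y` and would beat `y :: l`. Open lists may
revisit sites, so the extension is always admissible. -/
theorem IsMinimal.of_cons {e : Site d ↪ ℕ} {c : EdgeMarks d} {y : Site d} {l : List (Site d)}
    (h : IsMinimal e c (y :: l)) : IsMinimal e c l := by
  refine ⟨h.1.2, fun b hb htip => ?_⟩
  by_contra hlt
  have h1 := pathKey_cons_lt_cons y htip (not_le.1 hlt)
  exact h1.not_ge (h.2 (y :: b) ⟨htip ▸ h.1.1, hb⟩ rfl)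

theorem IsMinimal.of_suffix {e : Site d ↪ ℕ} {c : EdgeMarks d} {l l' : List (Site d)}
    (h : IsMinimal e c l) (hl : l' <:+ l) : IsMinimal e c l' := by
  induction l with
  | nil => rwa [List.suffix_nil.1 hl]
  | cons y l ih =>
    rcases List.suffix_cons_iff.1 hl with rfl | hl
    · exact h
    · exact ih h.of_cons hl

/-- Paths to `tip l` do not precede `l` by minimality of `l`; paths to `y` do not precede `y :: l`,
which itself comes after `l`. -/
theorem IsMinimal.leading {e : Site d ↪ ℕ} {c : EdgeMarks d} {y : Site d} {l : List (Site d)}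
    (h : IsMinimal e c (y :: l)) : Leading e c s(tip l, y) l := by
  refine ⟨h.1.2, Sym2.mem_mk_left _ _, fun b hb htip => ?_⟩
  rcases Sym2.mem_iff.1 htip with htip | htip
  · exact h.of_cons.2 b hb htip
  · exact (pathKey_lt_cons e c y l).le.trans (h.2 b hb htip)

theorem isMinimal_nil (e : Site d ↪ ℕ) (c : EdgeMarks d) : IsMinimal e c [] := by
  have key : ∀ b, pathKey e c [] ≤ pathKey e c b := by
    intro b
    induction b with
    | nil => exact le_rfl
    | cons y b ih => exact ih.trans (pathKey_lt_cons e c y b).le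
  exact ⟨trivial, fun b _ _ => key b⟩

theorem IsMinimal.unique {e : Site d ↪ ℕ} {c : EdgeMarks d} {l l' : List (Site d)}
    (h : IsMinimal e c l) (h' : IsMinimal e c l') (htip : tip l = tip l') : l = l' :=
  pathKey_injective e c ((h.2 l' h'.1 htip.symm).antisymm (h'.2 l h.1 htip))

theorem cost_le_of_suffix (c : EdgeMarks d) {l l' : List (Site d)} (h : l' <:+ l) :
    cost c l' ≤ cost c l := by
  induction l with
  | nil => rw [List.suffix_nil.1 h]
  | cons y l ih =>
    rcases List.suffix_cons_iff.1 h with rfl | h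
    · exact le_rfl
    · exact (ih h).trans (le_add_of_nonneg_right (le_max_right _ _))

/-- Paths of the shortest-path tree are minimal. -/
theorem IsTreePath.isMinimal {e : Site d ↪ ℕ} {c : EdgeMarks d} (hc : ∀ ε, 0 ≤ c.2 ε)
    {z : Site d} {p : (sfpGraph (toEdgeConf c)).Walk 0 z} (hp : IsTreePath e (toEdgeConf c) p)
    {l : List (Site d)} (hl : IsOpen c l) (htip : tip l = z)
    (hcost : cost c l = lLength _ p) (hsupp : p.support = 0 :: l.reverse) :
    IsMinimal e c l := by
  classical
  refine ⟨hl, fun b hb hbl => ?_⟩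
  obtain ⟨q, hq1, hq2⟩ := exists_walk_of_list hc hb
  generalize tip b = z' at q hbl
  obtain rfl : z' = z := hbl.trans htip
  set r := q.reverse with hr
  have hr1 : lLength _ r = cost c b := (lLength_reverse _ _).trans hq1
  have hr2 : r.support = 0 :: b.reverse := by simp [hr, hq2]
  -- Competitors may have loops, whereas `IsShortest` compares paths only; with nonnegative weights,
  -- removing loops does not increase the length.
  have hle : lLength _ r.bypass ≤ lLength _ r :=
    List.Sublist.sum_le_sum ((r.edges_bypass_sublist_edges).map _) fun x hx => by
      obtain ⟨ε, -, rfl⟩ := List.mem_map.1 hx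
      exact hc ε
  have hlen : l.length = p.length := by
    have := congrArg List.length hsupp
    simpa using this.symm
  have hlenb : b.length = r.length := by
    have := congrArg List.length hr2
    simpa using this.symm
  have h1 := hp.1.2 _ r.bypass_isPath
  unfold pathKey
  rw [Prod.Lex.toLex_le_toLex, Prod.Lex.toLex_le_toLex]
  simp only
  rw [hcost, ← hr1, hlen, hlenb, ← hsupp, ← hr2]
  rcases (h1.trans hle).lt_or_eq with hlt | heq
  · exact .inl hlt
  · refine .inr ⟨heq, ?_⟩
    -- In case of equal lengths the loop-erased competitor is itself shortest, so the tie-breaking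
    -- of `p` applies to it. If the erasure saves no edge, it is `r` itself.
    have hshort : IsShortest (toEdgeConf c) r.bypass :=
      ⟨r.bypass_isPath, fun q hq => (hle.trans heq.ge).trans (hp.1.2 q hq)⟩
    have hlen' := r.length_bypass_le_length
    rcases hp.2 _ hshort with hlt | ⟨heq', hlex⟩
    · exact .inl (hlt.trans_le hlen')
    · rcases hlen'.lt_or_eq with hlt | heq''
      · exact .inl (heq' ▸ hlt)
      · rw [r.bypass_eq_self_of_length_le_length_bypass heq''.ge] at heq' hlex
        exact .inr ⟨heq', hlex⟩

/-! ### The embedding of the shortest-path tree -/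

/-- The individual whose ancestors are located at the sites of the list and have number `0`. -/
def toIndiv (l : List (Site d)) : Indiv d := l.map fun y => (y, 0)

theorem site_toIndiv : ∀ l : List (Site d), Indiv.site (toIndiv l) = tip l
  | [] => rfl
  | _ :: _ => rfl

theorem forall_mem_toIndiv (l : List (Site d)) : ∀ m ∈ toIndiv l, m.2 = 0 := by
  simp [toIndiv]

theorem map_fst_toIndiv (l : List (Site d)) : (toIndiv l).map Prod.fst = l := by
  simp [toIndiv, Function.comp_def]

/-- The Poisson branching random walk: the revealed coordinates are those of the percolation graph,
the others are those of an independent branching random walk. -/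
noncomputable def exploredBRW (e : Site d ↪ ℕ) (p : EdgeMarks d × BRWConf d) : BRWConf d :=
  explore BRWCoord.edge (BRWCoord.revealed e) p

/-- The last edge of a minimal path is claimed by the preceding piece, so both of its marks are
copied into the walk, whatever the reservoir `f` is. -/
theorem exploredBRW_of_isMinimal {e : Site d ↪ ℕ} {c : EdgeMarks d} (f : BRWConf d) {y : Site d}
    {l : List (Site d)} (h : IsMinimal e c (y :: l)) :
    (exploredBRW e (c, f)).1 (toIndiv l, y) = c.1 s(tip l, y) ∧
      (exploredBRW e (c, f)).2 (toIndiv (y :: l)) = c.2 s(tip l, y) := by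
  have hlead := h.leading
  constructor
  · have : c ∈ BRWCoord.revealed e (.inl (toIndiv l, y)) := by
      refine ⟨forall_mem_toIndiv l, ?_⟩
      change Leading e c s(Indiv.site (toIndiv l), y) ((toIndiv l).map Prod.fst)
      rwa [site_toIndiv, map_fst_toIndiv]
    exact (if_pos this).trans (congrArg (fun x => c.1 s(x, y)) (site_toIndiv l))
  · have : c ∈ BRWCoord.revealed e (.inr (toIndiv (y :: l))) := by
      refine ⟨⟨rfl, forall_mem_toIndiv l⟩, ?_⟩
      change Leading e c s(Indiv.site (toIndiv l), y) ((toIndiv l).map Prod.fst)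
      rwa [site_toIndiv, map_fst_toIndiv]
    exact (if_pos this).trans (congrArg (fun x => c.2 s(x, y)) (site_toIndiv l))

theorem born_of_isMinimal {e : Site d ↪ ℕ} {c : EdgeMarks d} (hc : ∀ ε, 0 ≤ c.2 ε) (f : BRWConf d)
    {l : List (Site d)} (h : IsMinimal e c l) :
    Born (thin (exploredBRW e (c, f))) (toIndiv l) ∧
      rootDist (thin (exploredBRW e (c, f))) (toIndiv l) = cost c l := by
  induction l with
  | nil => exact ⟨trivial, rfl⟩
  | cons y l ih =>
    obtain ⟨h1, h2⟩ := ih h.of_cons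
    obtain ⟨k1, k2⟩ := exploredBRW_of_isMinimal f h
    constructor
    · refine ⟨?_, h1⟩
      change 0 < min 1 ((exploredBRW e (c, f)).1 (toIndiv l, y))
      rw [k1]
      exact lt_min one_pos h.1.1.1
    · change rootDist _ (toIndiv l) + (exploredBRW e (c, f)).2 (toIndiv (y :: l)) = _
      rw [h2, k2, cost, max_eq_left (hc _)]

open Classical in
/-- The individual that represents a site of the shortest-path tree. -/
noncomputable def embedding (e : Site d ↪ ℕ) (c : EdgeMarks d) (x : Site d) : Indiv d :=
  if h : ∃ l, IsMinimal e c l ∧ tip l = x then toIndiv h.choose else []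

/-- Minimal paths with the same end coincide, so the choice in `embedding` is harmless; no time
horizon enters, which gives one map for all `t`. -/
theorem embedding_tip {e : Site d ↪ ℕ} {c : EdgeMarks d} {l : List (Site d)}
    (h : IsMinimal e c l) : embedding e c (tip l) = toIndiv l := by
  have hex : ∃ l', IsMinimal e c l' ∧ tip l' = tip l := ⟨l, h, rfl⟩
  rw [embedding, dif_pos hex, hex.choose_spec.1.unique h hex.choose_spec.2]

theorem exists_isMinimal_of_isTreePath {e : Site d ↪ ℕ} {c : EdgeMarks d} (hc : ∀ ε, 0 ≤ c.2 ε)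
    {z : Site d} {p : (sfpGraph (toEdgeConf c)).Walk 0 z} (hp : IsTreePath e (toEdgeConf c) p) :
    (∀ x ∈ p.support, ∃ l, IsMinimal e c l ∧ tip l = x ∧ cost c l ≤ lLength _ p) ∧
      ∀ x y, (x, y) ∈ p.darts.map SimpleGraph.Dart.toProd →
        ∃ l, IsMinimal e c (y :: l) ∧ tip l = x ∧ cost c (y :: l) ≤ lLength _ p := by
  obtain ⟨l, h1, h2, h3, h4, h5, h6⟩ := exists_list_of_walk hc p.reverse rfl
  rw [lLength_reverse] at h3
  have hmin := hp.isMinimal hc h1 h2 h3 (by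
    have := congrArg List.reverse h4
    simpa using this)
  constructor
  · intro x hx
    obtain ⟨l', k1, k2⟩ := h5 x (by simpa using hx)
    exact ⟨l', hmin.of_suffix k1, k2, h3 ▸ cost_le_of_suffix c k1⟩
  · intro x y hxy
    obtain ⟨l', k1, k2⟩ := h6 y x (by
      obtain ⟨δ, hδ, heq⟩ := List.mem_map.1 hxy
      refine List.mem_map.2 ⟨δ.symm, ?_, ?_⟩
      · simpa [SimpleGraph.Walk.darts_reverse] using hδ
      · simp [heq])
    exact ⟨l', hmin.of_suffix k1, k2, h3 ▸ cost_le_of_suffix c k1⟩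

theorem shortestPathTree_isSubgraphVia (e : Site d ↪ ℕ) (w : Env d) {c : EdgeMarks d}
    (hc : ∀ ε, 0 ≤ c.2 ε) (f : BRWConf d) (t : ℝ) :
    (shortestPathTree e w (toEdgeConf c) t).IsSubgraphVia (embedding e c)
      (brwBall w (thin (exploredBRW e (c, f))) t) := by
  have hv : ∀ x ∈ (shortestPathTree e w (toEdgeConf c) t).verts,
      ∃ l, IsMinimal e c l ∧ tip l = x ∧ cost c l ≤ t := by
    rintro x ⟨z, p, hp, hpt, hx⟩
    obtain ⟨l, h1, h2, h3⟩ := (exists_isMinimal_of_isTreePath hc hp).1 x hx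
    exact ⟨l, h1, h2, h3.trans hpt⟩
  have he : ∀ x y, (shortestPathTree e w (toEdgeConf c) t).edge x y →
      ∃ l, IsMinimal e c (y :: l) ∧ tip l = x ∧ cost c (y :: l) ≤ t := by
    rintro x y ⟨z, p, hp, hpt, hxy⟩
    obtain ⟨l, h1, h2, h3⟩ := (exists_isMinimal_of_isTreePath hc hp).2 x y hxy
    exact ⟨l, h1, h2, h3.trans hpt⟩
  have hball : ∀ l, IsMinimal e c l → cost c l ≤ t →
      Born (thin (exploredBRW e (c, f))) (toIndiv l) ∧
        rootDist (thin (exploredBRW e (c, f))) (toIndiv l) ≤ t := fun l hl hlt =>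
    ⟨(born_of_isMinimal hc f hl).1, (born_of_isMinimal hc f hl).2 ▸ hlt⟩
  have hsite : ∀ x ∈ (shortestPathTree e w (toEdgeConf c) t).verts,
      Indiv.site (embedding e c x) = x := by
    intro x hx
    obtain ⟨l, hl, rfl, -⟩ := hv x hx
    rw [embedding_tip hl, site_toIndiv]
  refine ⟨embedding_tip (isMinimal_nil e c), fun x hx => ?_, fun x hx y hy hxy => ?_, hsite,
    fun x hx => congrArg w (hsite x hx), fun x y hxy => ?_, fun x y hxy => ?_⟩
  · obtain ⟨l, hl, rfl, hlt⟩ := hv x hx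
    rw [embedding_tip hl]
    exact hball l hl hlt
  -- The location map is a left inverse of the embedding on the tree.
  · rw [← hsite x hx, hxy, hsite y hy]
  · obtain ⟨l, hl, rfl, hlt⟩ := he x y hxy
    rw [embedding_tip hl.of_cons, show y = tip (y :: l) from rfl, embedding_tip hl]
    exact ⟨hball l hl.of_cons ((cost_le_of_suffix c (List.suffix_cons y l)).trans hlt),
      hball _ hl hlt, (y, 0), rfl⟩
  · obtain ⟨l, hl, rfl, hlt⟩ := he x y hxy
    rw [show embedding e c y = toIndiv (y :: l) from embedding_tip hl]
    exact (exploredBRW_of_isMinimal f hl).2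

/-! ### Laws of the marks -/

theorem measurable_poissonMeasure : Measurable poissonMeasure := by
  refine Measure.measurable_of_measurable_coe _ fun s hs => ?_
  simp_rw [poissonMeasure, Measure.sum_apply _ hs, Measure.smul_apply, smul_eq_mul]
  fun_prop

theorem measurable_rate (α lam : ℝ) (x y : Site d) :
    Measurable fun w : Env d => rate α lam w x y := by
  unfold rate
  split_ifs
  · exact measurable_const
  · fun_prop

theorem measurable_poiOffspring (α lam : ℝ) (x y : Site d) :
    Measurable fun w : Env d => poiOffspring α lam w x y := by
  have h := measurable_poissonMeasure.comp (measurable_rate α lam x y)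
  unfold poiOffspring
  split_ifs
  · exact (Measure.measurable_map _ .of_discrete).comp h
  · exact h

instance (α lam : ℝ) (w : Env d) (x y : Site d) :
    IsProbabilityMeasure (poiOffspring α lam w x y) := by
  unfold poiOffspring
  split_ifs
  · exact Measure.isProbabilityMeasure_map Measurable.of_discrete.aemeasurable
  · infer_instance

instance (α lam : ℝ) (w : Env d) (x y : Site d) :
    IsProbabilityMeasure (berOffspring α lam w x y) := by
  unfold berOffspring
  infer_instance

theorem poiOffspring_comm (α lam : ℝ) (w : Env d) (x y : Site d) :
    poiOffspring α lam w x y = poiOffspring α lam w y x := by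
  unfold poiOffspring
  simp only [eucl_comm x y, rate_comm α lam w x y]

/-- The law of the number of connections of an unordered pair of sites. -/
noncomputable def connLaw (α lam : ℝ) (w : Env d) : Sym2 (Site d) → Measure ℕ :=
  Sym2.lift ⟨poiOffspring α lam w, poiOffspring_comm α lam w⟩

instance (α lam : ℝ) (w : Env d) (ε : Sym2 (Site d)) :
    IsProbabilityMeasure (connLaw α lam w ε) := by
  induction ε with
  | _ x y => exact inferInstanceAs (IsProbabilityMeasure (poiOffspring α lam w x y))

theorem measurable_connLaw (α lam : ℝ) (ε : Sym2 (Site d)) :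
    Measurable fun w : Env d => connLaw α lam w ε := by
  induction ε with
  | _ x y => exact measurable_poiOffspring α lam x y

/-- Nearest neighbours always have the additional child; otherwise this is the Poisson mass at zero.
-/
theorem poiOffspring_singleton_zero (α lam : ℝ) (w : Env d) (x y : Site d) :
    (poiOffspring α lam w x y).real {0} = 1 - connProb α lam w x y := by
  unfold poiOffspring connProb
  split_ifs
  · rw [measureReal_def, Measure.map_apply .of_discrete (.singleton 0)]
    have : (fun n : ℕ => n + 1) ⁻¹' {0} = ∅ := by ext n; simp
    simp [this]
  · simp [poissonMeasure_real_singleton]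

/-- A function that only distinguishes `0` from the positive numbers maps the offspring law of the
Poisson branching random walk to a Bernoulli law. -/
theorem map_poiOffspring {S : Type*} [MeasurableSpace S] (α lam : ℝ) (w : Env d) (x y : Site d)
    {f : ℕ → S} {u v : S} (h0 : f 0 = v) (h1 : ∀ n, f (n + 1) = u) :
    (poiOffspring α lam w x y).map f = bernoulliMeasure u v (connProb α lam w x y) := by
  classical
  have : IsProbabilityMeasure ((poiOffspring α lam w x y).map f) :=
    Measure.isProbabilityMeasure_map Measurable.of_discrete.aemeasurable
  ext s hs
  rw [← ENNReal.toReal_eq_toReal_iff' (measure_ne_top _ _) (measure_ne_top _ _)]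
  change Measure.real _ _ = Measure.real _ _
  rw [bernoulliMeasure_real_apply _ hs, measureReal_def, Measure.map_apply .of_discrete hs]
  change (poiOffspring α lam w x y).real (f ⁻¹' s) = _
  have hmem : ∀ n, f n ∈ s ↔ (n = 0 ∧ v ∈ s) ∨ (n ≠ 0 ∧ u ∈ s) := by
    rintro (_ | n)
    · simp [h0]
    · simp [h1]
  split_ifs with hu hv hv
  · have : f ⁻¹' s = Set.univ := by ext n; simp [hmem, hu, hv, em]
    simp [this]
  · have : f ⁻¹' s = {0}ᶜ := by ext n; simp [hmem, hu, hv]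
    rw [this, probReal_compl_eq_one_sub (.singleton 0), poiOffspring_singleton_zero]
    simp
  · have : f ⁻¹' s = {0} := by ext n; simp [hmem, hu, hv]
    rw [this, poiOffspring_singleton_zero]
    simp
  · have : f ⁻¹' s = ∅ := by ext n; simp [hmem, hu, hv]
    simp [this]

theorem map_connLaw (α lam : ℝ) (w : Env d) (ε : Sym2 (Site d)) :
    (connLaw α lam w ε).map (fun n => decide (1 ≤ n)) =
      bernoulliMeasure true false (connProbSym α lam w ε) := by
  induction ε with
  | _ x y => exact map_poiOffspring α lam w x y (by simp) (by simp)

/-! ### Laws of the processes -/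

variable (α lam : ℝ) (ρ : Measure ℝ)

/-- The law of the marks of the edges of the percolation graph given the environment. -/
noncomputable def markLaw (w : Env d) : Measure (EdgeMarks d) :=
  (Measure.infinitePi (connLaw α lam w)).prod (Measure.infinitePi fun _ => ρ)

/-- The law of the marks and of an independent Poisson branching random walk given the
environment. -/
noncomputable def sampleLaw (w : Env d) : Measure (EdgeMarks d × BRWConf d) :=
  (markLaw α lam ρ w).prod (brwLaw (poiOffspring α lam w) ρ)

variable [IsProbabilityMeasure ρ]

instance (w : Env d) : IsProbabilityMeasure (markLaw α lam ρ w) := by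
  unfold markLaw
  infer_instance

instance (w : Env d) : IsProbabilityMeasure (brwLaw (poiOffspring α lam w) ρ) := by
  unfold brwLaw
  infer_instance

instance (w : Env d) : IsProbabilityMeasure (sampleLaw α lam ρ w) := by
  unfold sampleLaw
  infer_instance

theorem measurable_prod_of_measurable {Θ A B : Type*} [MeasurableSpace Θ] [MeasurableSpace A]
    [MeasurableSpace B] {κ : Θ → Measure A} {η : Θ → Measure B}
    [∀ w, IsProbabilityMeasure (κ w)] [∀ w, IsProbabilityMeasure (η w)]
    (hκ : Measurable κ) (hη : Measurable η) : Measurable fun w => (κ w).prod (η w) := by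
  have : IsMarkovKernel (⟨κ, hκ⟩ : Kernel Θ A) :=
    ⟨fun w => inferInstanceAs (IsProbabilityMeasure (κ w))⟩
  have : IsMarkovKernel (⟨η, hη⟩ : Kernel Θ B) :=
    ⟨fun w => inferInstanceAs (IsProbabilityMeasure (η w))⟩
  have h : (fun w => (κ w).prod (η w)) =
      ⇑((⟨κ, hκ⟩ : Kernel Θ A) ×ₖ (⟨η, hη⟩ : Kernel Θ B)) := by
    funext w
    rw [Kernel.prod_apply]
    rfl
  rw [h]
  exact Kernel.measurable _

theorem measurable_sampleLaw : Measurable fun w : Env d => sampleLaw α lam ρ w :=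
  measurable_prod_of_measurable
    (measurable_prod_of_measurable
      (measurable_infinitePi _ fun ε => measurable_connLaw α lam ε) measurable_const)
    (measurable_prod_of_measurable
      (measurable_infinitePi _ fun _ => measurable_poiOffspring α lam _ _) measurable_const)

/-- The conditional law of the marks and the independent branching random walk as a kernel. -/
noncomputable def sampleKernel : Kernel (Env d) (EdgeMarks d × BRWConf d) :=
  ⟨sampleLaw α lam ρ, measurable_sampleLaw α lam ρ⟩

instance : IsMarkovKernel (sampleKernel (d := d) α lam ρ) :=
  ⟨fun w => inferInstanceAs (IsProbabilityMeasure (sampleLaw α lam ρ w))⟩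

theorem measurable_toEdgeConf : Measurable (toEdgeConf : EdgeMarks d → EdgeConf d) :=
  Measurable.prodMk (measurable_pi_lambda _ fun ε =>
    (Measurable.of_discrete (f := fun n : ℕ => decide (1 ≤ n))).comp
      ((measurable_pi_apply ε).comp measurable_fst)) measurable_snd

theorem measurable_thin : Measurable (thin : BRWConf d → BRWConf d) :=
  Measurable.prodMk (measurable_pi_lambda _ fun i =>
    (Measurable.of_discrete (f := fun n : ℕ => min 1 n)).comp
      ((measurable_pi_apply i).comp measurable_fst)) measurable_snd

theorem measurable_exploredBRW (e : Site d ↪ ℕ) : Measurable (exploredBRW e) :=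
  measurable_explore (BRWCoord.isExploration e).measurableSet

theorem map_toEdgeConf_sampleLaw (w : Env d) :
    (sampleLaw α lam ρ w).map (fun p => toEdgeConf p.1) = sfpLaw α lam ρ w := by
  have h1 : (sampleLaw α lam ρ w).map Prod.fst = markLaw α lam ρ w := by
    rw [sampleLaw, Measure.map_fst_prod, measure_univ, one_smul]
  have h2 : Measurable fun (x : Sym2 (Site d) → ℕ) ε => decide (1 ≤ x ε) :=
    measurable_pi_lambda _ fun ε =>
      (Measurable.of_discrete (f := fun n : ℕ => decide (1 ≤ n))).comp (measurable_pi_apply ε)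
  rw [show (fun p : EdgeMarks d × BRWConf d => toEdgeConf p.1) = toEdgeConf ∘ Prod.fst from rfl,
    ← Measure.map_map measurable_toEdgeConf measurable_fst, h1, markLaw, sfpLaw]
  simp_rw [← map_connLaw]
  rw [← Measure.infinitePi_map_pi _ fun _ => .of_discrete]
  conv_rhs => rw [← Measure.map_id (μ := Measure.infinitePi fun _ : Sym2 (Site d) => ρ)]
  rw [Measure.map_prod_map _ _ h2 measurable_id]
  rfl

/-- The offspring law of a coordinate is by definition `connLaw` of its edge, so marks and reservoir
have matching laws and `IsExploration.map_explore` applies directly. -/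
theorem map_exploredBRW_sampleLaw (e : Site d ↪ ℕ) (w : Env d) :
    (sampleLaw α lam ρ w).map (exploredBRW e) = brwLaw (poiOffspring α lam w) ρ :=
  (BRWCoord.isExploration e).map_explore (connLaw α lam w) fun _ => ρ

theorem map_thin_brwLaw (w : Env d) :
    (brwLaw (poiOffspring α lam w) ρ).map thin = brwLaw (berOffspring α lam w) ρ := by
  have h1 : ∀ x y, (poiOffspring α lam w x y).map (fun n => min 1 n) =
      berOffspring α lam w x y := fun x y =>
    map_poiOffspring α lam w x y (by simp) (by simp)
  have h2 : Measurable fun (x : Indiv d × Site d → ℕ) i => min 1 (x i) :=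
    measurable_pi_lambda _ fun i =>
      (Measurable.of_discrete (f := fun n : ℕ => min 1 n)).comp (measurable_pi_apply i)
  rw [brwLaw, brwLaw]
  simp_rw [← h1]
  rw [← Measure.infinitePi_map_pi _ fun _ => .of_discrete]
  conv_rhs => rw [← Measure.map_id (μ := Measure.infinitePi fun _ : Indiv d => ρ)]
  rw [Measure.map_prod_map _ _ h2 measurable_id]
  rfl

theorem hasLawInEnv_compProd {Θ S : Type} [MeasurableSpace Θ] [MeasurableSpace S]
    (ν : Measure ℝ) [IsProbabilityMeasure ν] (κ : Kernel (Env d) Θ) [IsMarkovKernel κ] {f : Θ → S}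
    (hf : Measurable f) {Q : Env d → Measure S} (h : ∀ w, (κ w).map f = Q w) :
    HasLawInEnv ((Measure.infinitePi fun _ : Site d => ν) ⊗ₘ κ) ν Prod.fst
      (fun ω => f ω.2) Q := by
  refine ⟨measurable_fst, hf.comp measurable_snd, fun A B hA hB => ?_⟩
  have : Prod.fst ⁻¹' A ∩ (fun ω : Env d × Θ => f ω.2) ⁻¹' B = A ×ˢ (f ⁻¹' B) := rfl
  rw [this, Measure.compProd_apply_prod hA (hf hB)]
  simp_rw [← h, Measure.map_apply hf hB]

theorem ae_nonneg_sampleLaw (hρ : ∀ᵐ l ∂ρ, 0 ≤ l) (w : Env d) :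
    ∀ᵐ p ∂sampleLaw α lam ρ w, ∀ ε, 0 ≤ p.1.2 ε := by
  rw [ae_all_iff]
  intro ε
  have h : MeasurePreserving (fun p : EdgeMarks d × BRWConf d => p.1.2 ε)
      (sampleLaw α lam ρ w) ρ :=
    (measurePreserving_eval_infinitePi (fun _ : Sym2 (Site d) => ρ) ε).comp
      (measurePreserving_snd.comp measurePreserving_fst)
  exact h.quasiMeasurePreserving.ae hρ

end SFPCoupling

/-! ### Assembly of the coupling -/

theorem mainTheorem9 (d : ℕ) (α lam : ℝ) (hα : 0 < α) (hlam : 0 < lam)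
    (ν ρ : Measure ℝ) [IsProbabilityMeasure ν] [IsProbabilityMeasure ρ]
    (hν : ∀ᵐ x ∂ν, 1 ≤ x) (hρ : ∀ᵐ l ∂ρ, 0 ≤ l) (e : Site d ↪ ℕ) :
    ∃ (Ω : Type) (_ : MeasurableSpace Ω) (P : Measure Ω) (_ : IsProbabilityMeasure P)
      (W : Ω → Env d) (XS : Ω → EdgeConf d) (XB XP : Ω → BRWConf d),
      HasLawInEnv P ν W XS (fun w => sfpLaw α lam ρ w) ∧
      HasLawInEnv P ν W XB (fun w => brwLaw (berOffspring α lam w) ρ) ∧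
      HasLawInEnv P ν W XP (fun w => brwLaw (poiOffspring α lam w) ρ) ∧
      (∀ᵐ ω ∂P, IsThinning (XB ω) (XP ω)) ∧
      ∀ᵐ ω ∂P, ∃ φ : Site d → Indiv d, ∀ t : ℝ, 0 ≤ t →
        (shortestPathTree e (W ω) (XS ω) t).IsSubgraphVia φ (brwBall (W ω) (XB ω) t) ∧
        (brwBall (W ω) (XB ω) t).IsSubgraphVia id (brwBall (W ω) (XP ω) t) := by
  refine ⟨Env d × (EdgeMarks d × BRWConf d), inferInstance,
    (Measure.infinitePi fun _ : Site d => ν) ⊗ₘ sampleKernel α lam ρ, inferInstance,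
    Prod.fst, fun ω => toEdgeConf ω.2.1, fun ω => thin (exploredBRW e ω.2),
    fun ω => exploredBRW e ω.2, ?_, ?_, ?_, ?_, ?_⟩
  · exact hasLawInEnv_compProd ν _ (measurable_toEdgeConf.comp measurable_fst)
      (map_toEdgeConf_sampleLaw α lam ρ)
  · refine hasLawInEnv_compProd ν _ (measurable_thin.comp (measurable_exploredBRW e)) fun w => ?_
    rw [← Measure.map_map measurable_thin (measurable_exploredBRW e)]
    exact (congrArg _ (map_exploredBRW_sampleLaw α lam ρ e w)).trans (map_thin_brwLaw α lam ρ w)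
  · exact hasLawInEnv_compProd ν _ (measurable_exploredBRW e)
      (map_exploredBRW_sampleLaw α lam ρ e)
  · exact ae_of_all _ fun ω => isThinning_thin _
  -- The exceptional null set comes only from negative edge-weights, for which `cost` and the
  -- `L`-length could differ.
  · have hnn : ∀ᵐ ω ∂((Measure.infinitePi fun _ : Site d => ν) ⊗ₘ sampleKernel α lam ρ),
        ∀ ε, 0 ≤ ω.2.1.2 ε := by
      refine Measure.ae_compProd_of_ae_ae ?_ (ae_of_all _ (ae_nonneg_sampleLaw α lam ρ hρ))
      have : {ω : Env d × (EdgeMarks d × BRWConf d) | ∀ ε, 0 ≤ ω.2.1.2 ε} =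
          ⋂ ε, {ω | 0 ≤ ω.2.1.2 ε} := by ext; simp
      rw [this]
      exact .iInter fun ε => measurableSet_le measurable_const (by fun_prop)
    filter_upwards [hnn] with ω hω
    exact ⟨embedding e ω.2.1, fun t _ =>
      ⟨shortestPathTree_isSubgraphVia e ω.1 hω ω.2.2 t, brwBall_thin_isSubgraphVia ω.1 _ t⟩⟩
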